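/- **Conventions.** All spaces are real. For a normed space $E$, let $\mathcal S(E)$ be the set of all separable closed linear subspaces of $E$, ordered by inclusion. A family $\mathcal R\subset\mathcal S(E)$ is *rich* if it is cofinal (every member of $\mathcal S(E)$ is contained in a member of $\mathcal R$) and $\sigma$-complete (every increasing sequence $R_1\subset R_2\subset\cdots$ in $\mathcal R$ has a least upper bound in $\mathcal S(E)$ that belongs to $\mathcal R$). A *block-family* in $Z_1\times\cdots\times Z_k\times X$ is a subset of $\mathcal S(Z_1\times\cdots\times Z_k\times X)$ all of whose members are of the form $U_1\times\cdots\times U_k\times V$ with $U_i\in\mathcal S(Z_i)$ and $V\in\mathcal S(X)$. A Banach space is *Asplund* if every continuous convex real-valued function on it is Fréchet differentiable at some point. For $f:X\to(-\infty,+\infty]$ and $x\in X$ with $f(x)<+\infty$, the Fréchet subdifferential $\partial_F f(x)$ is the set of all $x^*\in X^*$ such that for every $\varepsilon>0$ there is $\delta>0$ with $f(x+h)-f(x)-\langle x^*,h\rangle>-\varepsilon\|h\|$ whenever $h\in X$ and $0<\|h\|<\delta$; if $f(x)=+\infty$, then $\partial_F f(x)=\emptyset$. For a subspace $V\subset X$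 and $B\subset X^*$, put $B|_V=\{x^*|_V: x^*\in B\}\subset V^*$. **Theorem.** Let $X$ be an Asplund space, let $Z_1,\dots,Z_k$ be Banach spaces, let $z_i^*\in Z_i^*$, let $T_i:Z_i\to X$ be bounded linear operators ($i=1,\dots,k$), and let $f:X\to(-\infty,+\infty]$ be proper, i.e. $f\not\equiv+\infty$. Then there is a rich block-family $\mathcal R$ in $Z_1\times\cdots\times Z_k\times X$ such that for every $U_1\times\cdots\times U_k\times V\in\mathcal R$ we have $T_i(U_i)\subset V$ for $i=1,\dots,k$, and there is $Y\in\mathcal S(X^*)$ such that: (i) the assignment $Y\ni x^*\mapsto x^*|_V\in V^*$ is an isometry onto $V^*$; (ii) $\big(\partial_F f(v)\cap Y\big)|_V=\big(\partial_F f(v)\big)|_V=\partial_F(f|_V)(v)$ for every $v\in V$; (iii) $\|T_i^*x^*-z_i^*\|=\big\|(T_i|_{U_i})^*(x^*|_V)-z_i^*|_{U_i}\big\|$ for every $x^*\in Y$ and $i=1,\dots,k$, where $T_i|_{U_i}$ is regarded as an operator $U_i\to V$. -/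

import Mathlib

open Set TopologicalSpace

/-- A real normed space is Asplund if every continuous convex function on it is Fréchet
differentiable at some point. -/
def IsAsplund (X : Type*) [NormedAddCommGroup X] [NormedSpace ℝ X] : Prop :=
  ∀ g : X → ℝ, ConvexOn ℝ univ g → Continuous g → ∃ x, DifferentiableAt ℝ g x

/-- The poset, under inclusion, of all separable closed linear subspaces of `E`. -/
abbrev SepSubspace (E : Type*) [NormedAddCommGroup E] [NormedSpace ℝ E] : Type _ :=
  {V : Submodule ℝ E // IsClosed (V : Set E) ∧ IsSeparable (V : Set E)}

/-- A subset `R` of a poset is `σ`-complete if every increasing sequence in `R` has a least upper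
bound (in the whole poset) which belongs to `R`. -/
def IsSigmaComplete {P : Type*} [PartialOrder P] (R : Set P) : Prop :=
  ∀ r : ℕ → P, Monotone r → (∀ n, r n ∈ R) → ∃ s ∈ R, IsLUB (range r) s

/-- A subset of a poset is rich if it is cofinal and `σ`-complete. -/
def IsRich {P : Type*} [PartialOrder P] (R : Set P) : Prop :=
  IsCofinal R ∧ IsSigmaComplete R

/-- The block `U₁ × ⋯ × Uₖ × V`, a separable closed subspace of `Z₁ × ⋯ × Zₖ × X`. -/
def block {k : ℕ} {Z : Fin k → Type*} [∀ i, NormedAddCommGroup (Z i)] [∀ i, NormedSpace ℝ (Z i)]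
    {X : Type*} [NormedAddCommGroup X] [NormedSpace ℝ X]
    (U : ∀ i, SepSubspace (Z i)) (V : SepSubspace X) : SepSubspace ((∀ i, Z i) × X) :=
  ⟨(Submodule.pi univ fun i => (U i).1).prod V.1,
    (isClosed_set_pi fun i _ => (U i).2.1).prod V.2.1,
    (IsSeparable.univ_pi fun i => (U i).2.2).prod V.2.2⟩

/-- The restriction `x*|_V` of a functional to a subspace, as an element of `V*`. -/
def restrictDual {E : Type*} [NormedAddCommGroup E] [NormedSpace ℝ E] (V : Submodule ℝ E)
    (x' : StrongDual ℝ E) : StrongDual ℝ V :=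
  x'.domRestrict V

/-- The dual operator `T* : X* → Z*` of `T : Z → X`, `T* x* = x* ∘ T`. -/
noncomputable def dualOp {Z X : Type*} [NormedAddCommGroup Z] [NormedSpace ℝ Z] [NormedAddCommGroup X]
    [NormedSpace ℝ X] (T : Z →L[ℝ] X) : StrongDual ℝ X →L[ℝ] StrongDual ℝ Z :=
  ContinuousLinearMap.precomp ℝ T

/-- The extended real function `f` is proper: it takes values in `(-∞, +∞]` and is not identically
`+∞`. -/
def IsProperFun {X : Type*} (f : X → EReal) : Prop :=
  (∀ x, f x ≠ ⊥) ∧ ∃ x, f x ≠ ⊤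

/-- The Fréchet subdifferential of `f : X → (-∞, +∞]` at `x`: all `x* ∈ X*` such that for every
`ε > 0` there is `δ > 0` with `f (x + h) - f x - ⟨x*, h⟩ > -ε ‖h‖` whenever `0 < ‖h‖ < δ`.
It is empty where `f x = +∞`. -/
def frechetSubdiff {X : Type*} [NormedAddCommGroup X] [NormedSpace ℝ X] (f : X → EReal) (x : X) :
    Set (StrongDual ℝ X) :=
  {x' | f x < ⊤ ∧ ∀ ε : ℝ, 0 < ε → ∃ δ : ℝ, 0 < δ ∧ ∀ h : X, 0 < ‖h‖ → ‖h‖ < δ →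
    ((-(ε * ‖h‖) : ℝ) : EReal) < f (x + h) - f x - ((x' h : ℝ) : EReal)}

/-! ### Elementary subsets and a Löwenheim–Skolem theorem -/

section Elementary

open Filter Topology

/-! This is separable reduction by a continuous form of Löwenheim–Skolem. Put P = Z₁ × ⋯ × Zₖ × X
and take for the rich family those separable closed subspaces W that are elementary for the
distance, the addition, countably many operators, the zᵢ* and f. Elementary means that self-maps τ
of P move any finite part of P into W while almost preserving all these data and almost fixing W.
Cofinality is `exists_countable_isElementary_closure`; σ-completeness is
`IsElementary.closure_iUnion`. The coordinate projections among the operators force W to be a block.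

For a block in the family, the last coordinate of τ gives maps ρ from X eventually into V:
asymptotically an additive isometric retraction, preserving f in the limit. Y consists of the
functionals with x*(ρ x) → x*(x) along an ultrafilter. Evaluating on ρ x shows that restriction to V
is isometric on Y; extending by Hahn–Banach and taking the limit along ρ shows that it is onto V*.
Fréchet inequalities and norms on the subspaces pass to the whole spaces by the same limits. No
regularity of f is needed.

The Asplund property enters only to make Y separable: Y is isometric to V*, which is separable by
`IsAsplund.separableSpace_dual`. -/

/-- A subset `W` of `P` is elementary for `Φ` if, along some proper filter on the self-maps `τ` of
`P`, the values of `τ` eventually lie in `W`, and `τ` asymptotically fixes the points of `W` and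
preserves `Φ`. -/
def IsElementary {P Q : Type*} [TopologicalSpace P] [TopologicalSpace Q] (Φ : P → P → P → Q)
    (W : Set P) : Prop :=
  ∃ l : Filter (P → P), l.NeBot ∧ (∀ a, ∀ᶠ τ in l, τ a ∈ W) ∧
    (∀ a ∈ W, Tendsto (fun τ => τ a) l (𝓝 a)) ∧
    ∀ a b c, Tendsto (fun τ => Φ (τ a) (τ b) (τ c)) l (𝓝 (Φ a b c))

/-- The filters of the W n are glued by `atTop.bind`: an event is eventual if, for all large n, it
is eventual along `l n`. Points of the closure are only limits of points that are asymptotically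
fixed; since Φ determines the distance, τ almost preserves distances, so they are asymptotically
fixed too. -/
theorem IsElementary.closure_iUnion {P Q : Type*} [PseudoMetricSpace P] [TopologicalSpace Q]
    {Φ : P → P → P → Q} {δ : Q → ℝ} (hδ : Continuous δ) (hΦ : ∀ a b c, δ (Φ a b c) = dist a b)
    {W : ℕ → Set P} (hW : Monotone W) (h : ∀ n, IsElementary Φ (W n)) :
    IsElementary Φ (closure (⋃ n, W n)) := by
  choose l hne hmem hfix hpres using h
  have hbot : (atTop.bind l).NeBot := by
    refine ⟨fun hb => ?_⟩
    have h0 : ∀ᶠ _ in atTop.bind l, False := by simp [hb]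
    rw [eventually_bind] at h0
    obtain ⟨n, hn⟩ := h0.exists
    exact hn.exists.elim fun _ h => h
  refine ⟨atTop.bind l, hbot, fun a => ?_, fun a ha => ?_, fun a b c s hs => ?_⟩
  · rw [eventually_bind]
    refine Eventually.of_forall fun n => (hmem n a).mono fun τ hτ => ?_
    exact subset_closure (mem_iUnion_of_mem n hτ)
  · rw [Metric.tendsto_nhds]
    intro ε hε
    obtain ⟨b, hb, hab⟩ := Metric.mem_closure_iff.1 ha (ε / 4) (by positivity)
    obtain ⟨N, hN⟩ := mem_iUnion.1 hb
    rw [eventually_bind]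
    filter_upwards [eventually_ge_atTop N] with n hn
    have h1 : Tendsto (fun τ : P → P => dist (τ a) (τ b)) (l n) (𝓝 (dist a b)) := by
      simpa only [Function.comp_def, hΦ] using (hδ.tendsto _).comp (hpres n a b a)
    have h2 : ∀ᶠ τ in l n, dist (τ b) b < ε / 4 :=
      Metric.tendsto_nhds.1 (hfix n b (hW hn hN)) _ (by positivity)
    filter_upwards [h1.eventually_lt_const hab, h2] with τ h3 h4
    have := dist_triangle4 (τ a) (τ b) b a
    rw [dist_comm b a] at this
    linarith
  · rw [mem_map, mem_bind']
    exact Eventually.of_forall fun n => hpres n a b c hs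

/-- With the topology induced by Ψ, A is second countable, hence separable. -/
theorem exists_countable_forall_mem_nhds {A Q : Type*} [TopologicalSpace Q]
    [SecondCountableTopology Q] (Ψ : A → Q) :
    ∃ D : Set A, D.Countable ∧ ∀ x, ∀ O ∈ 𝓝 (Ψ x), ∃ y ∈ D, Ψ y ∈ O := by
  let _ : TopologicalSpace A := induced Ψ inferInstance
  have : SecondCountableTopology A := secondCountableTopology_induced A Q Ψ
  obtain ⟨D, hD, hd⟩ := TopologicalSpace.exists_countable_dense A
  refine ⟨D, hD, fun x O hO => ?_⟩
  have : Ψ ⁻¹' O ∈ 𝓝 x := by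
    rw [nhds_induced]
    exact preimage_mem_comap hO
  obtain ⟨y, hy, hyD⟩ := mem_closure_iff_nhds.1 (hd x) _ this
  exact ⟨y, hyD, hy⟩

/-- A Löwenheim–Skolem argument: every countable set lies in a countable set with elementary
closure. -/
theorem exists_countable_isElementary_closure {P Q : Type*} [PseudoMetricSpace P]
    [TopologicalSpace Q] [T3Space Q] [SecondCountableTopology Q]
    {Φ : P → P → P → Q} {δ : Q → ℝ} (hδ : Continuous δ) (hΦ : ∀ a b c, δ (Φ a b c) = dist a b)
    {S : Set P} (hS : S.Countable) :
    ∃ C, S ⊆ C ∧ C.Countable ∧ IsElementary Φ (closure C) := by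
  classical
  let _ : MetricSpace Q := metrizableSpaceMetric Q
  have key (c : Finset P) (n : ℕ) := exists_countable_forall_mem_nhds
    fun (x : Fin n → P) (i j k : Fin n ⊕ c) =>
      Φ (Sum.elim x (↑) i) (Sum.elim x (↑) j) (Sum.elim x (↑) k)
  choose D hDc hD using key
  -- For each finite parameter set c in C and each n, adjoin countably many n-tuples that
  -- approximate the Φ-values over c of every n-tuple of P.
  let step : Set P → Set P := fun C =>
    C ∪ ⋃ c ∈ {c : Finset P | (c : Set P) ⊆ C}, ⋃ n, ⋃ x ∈ D c n, range x
  have step_countable {C : Set P} (hC : C.Countable) : (step C).Countable := by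
    refine hC.union (Countable.biUnion ?_ fun c _ => countable_iUnion fun n =>
      (hDc c n).biUnion fun x _ => countable_range x)
    have := (countable_ofPred_finite_subset hC).preimage_of_injOn
      (f := ((↑) : Finset P → Set P)) Finset.coe_injective.injOn
    refine this.mono fun c hc => ?_
    exact And.intro c.finite_toSet hc
  have hit (n : ℕ) : (step^[n] S).Countable := by
    induction n with
    | zero => exact hS
    | succ n ih => rw [Function.iterate_succ_apply']; exact step_countable ih
  have hmono : Monotone fun n => step^[n] S := monotone_nat_of_le_succ fun n => by
    rw [Function.iterate_succ_apply']; exact subset_union_left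
  set C := ⋃ n, step^[n] S with hC
  have claim (A : Finset P) (ε : ℝ) (hε : 0 < ε) : ∃ τ : P → P, (∀ a ∈ A, τ a ∈ closure C) ∧
      (∀ a ∈ A, a ∈ closure C → dist (τ a) a < 3 * ε) ∧
      ∀ a ∈ A, ∀ b ∈ A, ∀ c ∈ A, dist (Φ (τ a) (τ b) (τ c)) (Φ a b c) < ε := by
    have hp (a : P) : ∃ c, a ∈ closure C → c ∈ C ∧ dist a c < ε := by
      by_cases ha : a ∈ closure C
      · obtain ⟨c, hc⟩ := Metric.mem_closure_iff.1 ha ε hε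
        exact ⟨c, fun _ => hc⟩
      · exact ⟨a, fun h => absurd h ha⟩
    choose p hp using hp
    let c : Finset P := (A.filter (· ∈ closure C)).image p
    have hcC : (c : Set P) ⊆ C := by
      intro y hy
      obtain ⟨a, ha, rfl⟩ := Finset.mem_image.1 (Finset.mem_coe.1 hy)
      exact (hp a (Finset.mem_filter.1 ha).2).1
    obtain ⟨k, hk⟩ : ∃ k, (c : Set P) ⊆ step^[k] S :=
      hmono.directed_le.exists_mem_subset_of_finset_subset_biUnion hcC
    let x : Fin A.card → P := fun i => (A.equivFin.symm i).1
    -- The tuple y imitates the enumeration x of A over the parameters c. Closeness of δ is demanded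
    -- separately, since δ is continuous but perhaps not uniformly so for the chosen metric on Q.
    obtain ⟨y, hyD, hy⟩ := hD c A.card x
      {t | ∀ i j k, dist (t i j k)
          (Φ (Sum.elim x (↑) i) (Sum.elim x (↑) j) (Sum.elim x (↑) k)) < ε ∧
        dist (δ (t i j k))
          (δ (Φ (Sum.elim x (↑) i) (Sum.elim x (↑) j) (Sum.elim x (↑) k))) < ε} (by
        refine eventually_all.2 fun i => eventually_all.2 fun j => eventually_all.2 fun k => ?_
        have ht : Continuous fun t : (Fin A.card ⊕ c) → (Fin A.card ⊕ c) → (Fin A.card ⊕ c) → Q =>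
          t i j k := by fun_prop
        exact (Metric.tendsto_nhds.1 (ht.tendsto _) ε hε).and
          (Metric.tendsto_nhds.1 ((hδ.comp ht).tendsto _) ε hε))
    have hyC (i) : y i ∈ C := by
      refine mem_iUnion.2 ⟨k + 1, ?_⟩
      rw [Function.iterate_succ_apply']
      exact Or.inr (mem_biUnion (show c ∈ {c : Finset P | (c : Set P) ⊆ _} from hk)
        (mem_iUnion.2 ⟨_, mem_biUnion hyD (mem_range_self i)⟩))
    let τ : P → P := fun a => if h : a ∈ A then y (A.equivFin ⟨a, h⟩) else a
    have hτ {a : P} (h : a ∈ A) : τ a = y (A.equivFin ⟨a, h⟩) := dif_pos h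
    have hx {a : P} (h : a ∈ A) : x (A.equivFin ⟨a, h⟩) = a := by simp [x]
    refine ⟨τ, fun a ha => ?_, fun a ha haC => ?_, fun a ha b hb d hd => ?_⟩
    · rw [hτ ha]; exact subset_closure (hyC _)
    -- The point a of the closure need not be a parameter, but its approximant p a is. Then τ a is
    -- within 2ε of p a, which is within ε of a: hence 3ε.
    · have hpc : p a ∈ c := Finset.mem_image_of_mem p (Finset.mem_filter.2 ⟨ha, haC⟩)
      have h1 := (hy (Sum.inl (A.equivFin ⟨a, ha⟩)) (Sum.inr ⟨p a, hpc⟩)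
        (Sum.inr ⟨p a, hpc⟩)).2
      simp only [Sum.elim_inl, Sum.elim_inr, hΦ, hx ha, ← hτ ha, Real.dist_eq] at h1
      have h2 := (hp a haC).2
      have h3 := dist_triangle (τ a) (p a) a
      rw [dist_comm (p a) a] at h3
      linarith [(abs_lt.1 h1).2]
    · have h1 := (hy (Sum.inl (A.equivFin ⟨a, ha⟩)) (Sum.inl (A.equivFin ⟨b, hb⟩))
        (Sum.inl (A.equivFin ⟨d, hd⟩))).1
      simpa only [Sum.elim_inl, hx, ← hτ] using h1
  refine ⟨C, subset_iUnion (fun n => step^[n] S) 0, countable_iUnion hit, ?_⟩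
  -- The filter is that of the finite sets A growing and the tolerance 1/(n+1) shrinking.
  have claim' (i : Finset P × ℕ) := claim i.1 (1 / (i.2 + 1)) Nat.one_div_pos_of_nat
  choose τ h1 h2 h3 using claim'
  have hA (a : P) : ∀ᶠ i : Finset P × ℕ in atTop, a ∈ i.1 := by
    filter_upwards [eventually_ge_atTop (({a} : Finset P), 0)] with i hi
    exact hi.1 (Finset.mem_singleton_self a)
  have hn : Tendsto (fun i : Finset P × ℕ => 1 / ((i.2 : ℝ) + 1)) atTop (𝓝 0) := by
    refine tendsto_one_div_add_atTop_nhds_zero_nat.comp ?_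
    rw [← prod_atTop_atTop_eq]
    exact tendsto_snd
  refine ⟨map τ atTop, inferInstance, fun a => (hA a).mono fun i hi => h1 i a hi,
    fun a ha => ?_, fun a b c => ?_⟩
  · rw [tendsto_map'_iff, tendsto_iff_dist_tendsto_zero]
    refine squeeze_zero' (Eventually.of_forall fun _ => dist_nonneg)
      ((hA a).mono fun i hi => (h2 i a hi ha).le) ?_
    simpa using hn.const_mul 3
  · rw [tendsto_map'_iff, tendsto_iff_dist_tendsto_zero]
    refine squeeze_zero' (Eventually.of_forall fun _ => dist_nonneg) ?_ hn
    filter_upwards [hA a, hA b, hA c] with i ha hb hc using (h3 i a ha b hb c hc).le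

end Elementary

/-! ### Separable subspaces of Asplund spaces have separable dual -/

section Asplund

open Filter Topology

/-- Bounded nonempty subsets of the dual of an Asplund space have weak* slices of arbitrarily small
diameter: the support function is differentiable somewhere. -/
theorem IsAsplund.exists_slice_small {X : Type*} [NormedAddCommGroup X] [NormedSpace ℝ X]
    (hX : IsAsplund X) {K : Set (StrongDual ℝ X)} (hne : K.Nonempty) {r : ℝ}
    (hK : ∀ a ∈ K, ‖a‖ ≤ r) {ε : ℝ} (hε : 0 < ε) :
    ∃ (x : X) (t : ℝ), (∃ a ∈ K, t < a x) ∧ ∀ a ∈ K, ∀ b ∈ K, t < a x → t < b x → ‖a - b‖ < ε := by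
  have hr : 0 ≤ r := (norm_nonneg _).trans (hK _ hne.some_mem)
  have : Nonempty K := hne.to_subtype
  have hbound (a : K) (x : X) : a.1 x ≤ r * ‖x‖ :=
    (le_abs_self _).trans (a.1.le_of_opNorm_le (hK a a.2) x)
  have hbdd (x : X) : BddAbove (range fun a : K => a.1 x) :=
    ⟨r * ‖x‖, by rintro _ ⟨a, rfl⟩; exact hbound a x⟩
  set g : X → ℝ := fun x => ⨆ a : K, a.1 x with hg
  have hle (a : K) (x : X) : a.1 x ≤ g x := le_ciSup (hbdd x) a
  have hconv : ConvexOn ℝ univ g := by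
    refine ⟨convex_univ, fun x _ y _ s t hs ht _ => ciSup_le fun a => ?_⟩
    rw [map_add, map_smul, map_smul]
    exact add_le_add (smul_le_smul_of_nonneg_left (hle a x) hs)
      (smul_le_smul_of_nonneg_left (hle a y) ht)
  have hcont : Continuous g := by
    refine (LipschitzWith.of_le_add_mul ⟨r, hr⟩ fun x y => ciSup_le fun a => ?_).continuous
    have h1 := hbound a (x - y)
    rw [map_sub] at h1
    rw [dist_eq_norm]
    show _ ≤ g y + r * ‖x - y‖
    linarith [hle a y]
  obtain ⟨x, hx⟩ := hX g hconv hcont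
  obtain ⟨δ, hδ, hδx⟩ := Metric.eventually_nhds_iff.1
    ((hasFDerivAt_iff_isLittleO_nhds_zero.1 hx.hasFDerivAt).def (show 0 < ε / 16 by positivity))
  set d := fderiv ℝ g x
  set ρ := δ / 2 with hρ
  have hρ0 : 0 < ρ := by positivity
  obtain ⟨a, ha⟩ := exists_lt_of_lt_ciSup (show g x - ε / 16 * ρ < g x by
    have : 0 < ε / 16 * ρ := by positivity
    linarith)
  -- A functional b almost attaining g at x is close to the derivative d: b(x + k) ≤ g(x + k) gives
  -- (b - d)k ≤ (ε/16)(‖k‖ + ρ), and ρ ≤ 2‖k‖ on the shell ρ/2 ≤ ‖k‖ < ρ.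
  have hnear (b : StrongDual ℝ X) (hb : b ∈ K) (hbx : g x - ε / 16 * ρ < b x) :
      ‖b - d‖ ≤ 3 / 16 * ε := by
    refine ContinuousLinearMap.opNorm_le_of_shell' (f := b - d) hρ0 (by positivity)
      (c := (1 / 2 : ℝ)) (by norm_num) fun h h1 h2 => ?_
    have half (k : X) (hk : ‖k‖ = ‖h‖) : (b - d) k ≤ 3 / 16 * ε * ‖h‖ := by
      have h3 : ‖g (x + k) - g x - d k‖ ≤ ε / 16 * ‖k‖ := hδx (y := k) (by
        rw [dist_zero_right]; linarith)
      have h4 := (le_abs_self _).trans h3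
      have h5 := hle ⟨b, hb⟩ (x + k)
      simp only [map_add] at h5
      have h6 : ε * ρ ≤ ε * (2 * ‖h‖) := by
        refine mul_le_mul_of_nonneg_left ?_ hε.le
        rw [Real.norm_of_nonneg (by norm_num)] at h1
        linarith
      rw [hk] at h4
      show b k - d k ≤ _
      linarith
    have h7 := half (-h) (norm_neg h)
    rw [map_neg] at h7
    exact abs_le.2 ⟨by linarith, half h rfl⟩
  refine ⟨x, g x - ε / 16 * ρ, ⟨a.1, a.2, ha⟩, fun b hb c hc hbx hcx => ?_⟩
  have h1 := norm_sub_le (b - d) (c - d)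
  rw [sub_sub_sub_cancel_right] at h1
  linarith [hnear b hb hbx, hnear c hc hcx]

/-- The restriction of functionals to a subspace is continuous for the weak* topologies. -/
theorem continuous_restrict_weakDual {X : Type*} [NormedAddCommGroup X] [NormedSpace ℝ X]
    (V : Submodule ℝ X) : Continuous fun x' : WeakDual ℝ X =>
      StrongDual.toWeakDual (restrictDual V (WeakDual.toStrongDual x')) :=
  WeakDual.continuous_of_continuous_eval fun v => WeakDual.eval_continuous (v : X)

/-- A nonseparable dual of a separable space has a nonempty weak* compact subset `K` of the ball
whose relatively weak* open subsets all have diameter at least some `ε > 0`. -/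
theorem exists_weakDual_fragmentless {V : Type*} [NormedAddCommGroup V] [NormedSpace ℝ V]
    [SeparableSpace V] (h : ¬ IsSeparable (Metric.closedBall (0 : StrongDual ℝ V) 1)) :
    ∃ ε > 0, ∃ K : Set (WeakDual ℝ V), K.Nonempty ∧ IsCompact K ∧
      K ⊆ WeakDual.toStrongDual ⁻¹' Metric.closedBall 0 1 ∧
      ∀ O : Set (WeakDual ℝ V), IsOpen O → (O ∩ K).Nonempty →
        ∃ a ∈ O ∩ K, ∃ b ∈ O ∩ K,
          ε ≤ ‖WeakDual.toStrongDual a - WeakDual.toStrongDual b‖ := by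
  set B : Set (WeakDual ℝ V) := WeakDual.toStrongDual ⁻¹' Metric.closedBall 0 1 with hB
  have hBc : IsCompact B := WeakDual.isCompact_closedBall 0 1
  have := isCompact_iff_compactSpace.1 hBc
  have := WeakDual.metrizable_of_isCompact ℝ V B hBc
  let _ := metrizableSpaceMetric B
  let small (ε : ℝ) (A : Set (WeakDual ℝ V)) : Prop :=
    ∃ D : Set (WeakDual ℝ V), D.Countable ∧ ∀ a ∈ A, ∃ d ∈ D,
      ‖WeakDual.toStrongDual a - WeakDual.toStrongDual d‖ < ε
  obtain ⟨ε, hε, hns⟩ : ∃ ε > 0, ¬ small ε B := by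
    by_contra! hall
    refine h ?_
    choose! D hD hDB using fun n : ℕ => hall (1 / (n + 1)) Nat.one_div_pos_of_nat
    refine ⟨⋃ n, WeakDual.toStrongDual '' D n, countable_iUnion fun n => (hD n).image _,
      fun a ha => Metric.mem_closure_iff.2 fun ε hε => ?_⟩
    obtain ⟨n, hn⟩ := exists_nat_one_div_lt hε
    obtain ⟨d, hd, hda⟩ := hDB n (StrongDual.toWeakDual a) ha
    refine ⟨WeakDual.toStrongDual d, mem_iUnion_of_mem n (mem_image_of_mem _ hd), ?_⟩
    rw [dist_eq_norm]
    exact hda.trans hn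
  -- As in Cantor–Bendixson, remove from the metrizable compact ball every basic open set that is
  -- covered by countably many ε-balls. Their countable union is again so covered, hence K is
  -- nonempty.
  let 𝓤 : Set (Set B) := {O | O ∈ countableBasis B ∧ small ε ((↑) '' O)}
  have h𝓤 : 𝓤.Countable := (countable_countableBasis B).mono fun O hO => hO.1
  have hopen : IsOpen (⋃₀ 𝓤) := isOpen_sUnion fun O hO => isOpen_of_mem_countableBasis hO.1
  have hsmall : small ε ((↑) '' ⋃₀ 𝓤) := by
    choose! D hD hDO using fun O (hO : O ∈ 𝓤) => hO.2
    refine ⟨⋃ O ∈ 𝓤, D O, h𝓤.biUnion hD, ?_⟩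
    rintro _ ⟨a, ⟨O, hO, haO⟩, rfl⟩
    obtain ⟨d, hd, hda⟩ := hDO O hO a (mem_image_of_mem _ haO)
    exact ⟨d, mem_biUnion hO hd, hda⟩
  have hunion {A A' : Set (WeakDual ℝ V)} (hA : small ε A) (hA' : small ε A') :
      small ε (A ∪ A') := by
    obtain ⟨D, hD, hDA⟩ := hA
    obtain ⟨D', hD', hDA'⟩ := hA'
    refine ⟨D ∪ D', hD.union hD', ?_⟩
    rintro a (ha | ha)
    · obtain ⟨d, hd, hda⟩ := hDA a ha
      exact ⟨d, Or.inl hd, hda⟩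
    · obtain ⟨d, hd, hda⟩ := hDA' a ha
      exact ⟨d, Or.inr hd, hda⟩
  have hmono {A A' : Set (WeakDual ℝ V)} (hA : small ε A) (hA' : A' ⊆ A) : small ε A' := by
    obtain ⟨D, hD, hDA⟩ := hA
    exact ⟨D, hD, fun a ha => hDA a (hA' ha)⟩
  set K : Set (WeakDual ℝ V) := (↑) '' (⋃₀ 𝓤)ᶜ with hK
  have hKB : B = K ∪ (↑) '' ⋃₀ 𝓤 := by
    rw [hK, ← image_union, compl_union_self, image_univ, Subtype.range_coe]
  refine ⟨ε, hε, K, ?_, hopen.isClosed_compl.isCompact.image continuous_subtype_val,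
    (by rw [hKB]; exact subset_union_left), fun O hO hOK => ?_⟩
  · rw [nonempty_iff_ne_empty]
    intro h0
    rw [h0, empty_union] at hKB
    exact hns (by rw [hKB]; exact hsmall)
  · obtain ⟨a, haO, ⟨a', ha', rfl⟩⟩ := hOK
    -- Otherwise a basic neighbourhood of a' would be small, being contained in O ∩ K together with
    -- the removed part, and a' would have been removed.
    have hns' : ¬ small ε (O ∩ K) := by
      intro hs
      obtain ⟨O', hO', haO', hO'O⟩ := (isBasis_countableBasis B).exists_subset_of_mem_open
        (show a' ∈ (↑) ⁻¹' O from haO) (hO.preimage continuous_subtype_val)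
      refine ha' ⟨O', ⟨hO', hmono (hunion hs hsmall) ?_⟩, haO'⟩
      rintro _ ⟨b, hb, rfl⟩
      by_cases hb' : b ∈ ⋃₀ 𝓤
      · exact Or.inr (mem_image_of_mem _ hb')
      · exact Or.inl ⟨hO'O hb, mem_image_of_mem _ hb'⟩
    refine ⟨a', ⟨haO, mem_image_of_mem _ ha'⟩, ?_⟩
    by_contra! hall
    refine hns' ⟨{a'.1}, countable_singleton _, fun b hb => ⟨a', rfl, ?_⟩⟩
    rw [norm_sub_rev]
    exact hall b hb

theorem TopologicalSpace.IsSeparable.separableSpace_of_closedBall {E : Type*}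
    [NormedAddCommGroup E] [NormedSpace ℝ E] (h : IsSeparable (Metric.closedBall (0 : E) 1)) :
    SeparableSpace E := by
  have : (univ : Set E) = ⋃ n : ℕ, (fun a => (n : ℝ) • a) '' Metric.closedBall (0 : E) 1 := by
    refine (eq_univ_of_forall fun a => mem_iUnion.2 ?_).symm
    obtain ⟨n, hn⟩ := exists_nat_gt ‖a‖
    have hn0 : (0 : ℝ) < n := (norm_nonneg a).trans_lt hn
    refine ⟨n, (n : ℝ)⁻¹ • a, ?_, smul_inv_smul₀ hn0.ne' a⟩
    rw [mem_closedBall_zero_iff, norm_smul, norm_inv, Real.norm_natCast, inv_mul_le_one₀ hn0]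
    exact hn.le
  rw [← isSeparable_univ_iff, this]
  exact IsSeparable.iUnion fun n => h.image (continuous_const_smul _)

/-- The dual of a separable subspace of an Asplund space is separable. -/
theorem IsAsplund.separableSpace_dual {X : Type*} [NormedAddCommGroup X] [NormedSpace ℝ X]
    (hX : IsAsplund X) (V : Submodule ℝ X) [SeparableSpace V] :
    SeparableSpace (StrongDual ℝ V) := by
  suffices h : IsSeparable (Metric.closedBall (0 : StrongDual ℝ V) 1) by
    exact IsSeparable.separableSpace_of_closedBall (E := StrongDual ℝ V) h
  by_contra h
  obtain ⟨ε, hε, K, hKne, hKc, hKB, hKε⟩ := exists_weakDual_fragmentless h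
  let B : Set (WeakDual ℝ X) := WeakDual.toStrongDual ⁻¹' Metric.closedBall 0 1
  have hBc : IsCompact B := WeakDual.isCompact_closedBall 0 1
  let res : WeakDual ℝ X → WeakDual ℝ V := fun x' =>
    StrongDual.toWeakDual (restrictDual V (WeakDual.toStrongDual x'))
  have hres : Continuous res := continuous_restrict_weakDual V
  let D : Set (WeakDual ℝ X) := B ∩ res ⁻¹' K
  have hDc : IsCompact D := hBc.inter_right (hKc.isClosed.preimage hres)
  have := isCompact_iff_compactSpace.1 hDc
  let φ : D → K := fun x => ⟨res x.1, x.2.2⟩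
  have hφ : Continuous φ := (hres.comp continuous_subtype_val).subtype_mk _
  have hsurj : φ.Surjective := by
    rintro ⟨a, ha⟩
    obtain ⟨b, hb, hbn⟩ := exists_extension_norm_eq V (WeakDual.toStrongDual a)
    have hab : res (StrongDual.toWeakDual b) = a := DFunLike.ext _ _ hb
    refine ⟨⟨StrongDual.toWeakDual b, ?_, ?_⟩, ?_⟩
    · have := hKB ha
      exact mem_closedBall_zero_iff.2 (hbn.trans_le (mem_closedBall_zero_iff.1 this))
    · rw [mem_preimage, hab]; exact ha
    · exact Subtype.ext hab
  -- Choose E minimal among the closed sets that restriction maps onto K. Removing a small slice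
  -- from E leaves a closed proper subset, whose image misses part of K.
  obtain ⟨E, hEc, hE, hEmin⟩ := exists_compact_surjective_zorn_subset hφ hsurj
  have hEne : E.Nonempty := by
    obtain ⟨a, ha⟩ := hKne
    obtain ⟨e, he, -⟩ := hE.ge (mem_univ ⟨a, ha⟩)
    exact ⟨e, he⟩
  obtain ⟨x, t, ⟨_, ⟨a, ha, rfl⟩, hat⟩, hsl⟩ := hX.exists_slice_small
    (K := (fun e : D => WeakDual.toStrongDual e.1) '' E) (hEne.image _) (r := 1)
    (by rintro _ ⟨e, -, rfl⟩; simpa [B] using e.2.1) hε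
  have hev : Continuous fun e : E => (e.1.1 : WeakDual ℝ X) x :=
    (WeakDual.eval_continuous x).comp (continuous_subtype_val.comp continuous_subtype_val)
  let E₀ : Set E := {e | (e.1.1 : WeakDual ℝ X) x ≤ t}
  have hE₀ : IsClosed E₀ := isClosed_le hev continuous_const
  have hE₀ne : E₀ ≠ univ := fun h0 => by
    have : (⟨a, ha⟩ : E) ∈ E₀ := h0 ▸ mem_univ _
    exact absurd hat (not_lt.2 this)
  have himg := hEmin E₀ hE₀ne hE₀
  let F : Set (WeakDual ℝ V) := (↑) '' (E.domRestrict φ '' E₀)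
  have hF : IsClosed F := by
    refine (IsCompact.image ?_ continuous_subtype_val).isClosed
    exact hE₀.isCompact.image (hφ.comp continuous_subtype_val)
  obtain ⟨y, hy⟩ := (ne_univ_iff_exists_notMem _).1 himg
  have hyF : y.1 ∉ F := by
    rintro ⟨z, hz, hzy⟩
    exact hy (Subtype.ext hzy ▸ hz)
  obtain ⟨b, hb, c, hc, hbc⟩ := hKε Fᶜ hF.isOpen_compl ⟨y.1, hyF, y.2⟩
  -- Points of K outside F lift only into the slice. Restriction does not increase norms, so they
  -- are less than ε apart, against the choice of K.
  have lift {b : WeakDual ℝ V} (hb : b ∈ Fᶜ ∩ K) : ∃ e ∈ E, res e.1 = b ∧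
      t < (e.1 : WeakDual ℝ X) x := by
    obtain ⟨e, he, heb⟩ := hE.ge (mem_univ (⟨b, hb.2⟩ : K))
    refine ⟨e, he, congrArg Subtype.val heb, not_le.1 fun hle => hb.1 ?_⟩
    exact ⟨⟨b, hb.2⟩, ⟨⟨e, he⟩, hle, heb⟩, rfl⟩
  obtain ⟨e, he, rfl, het⟩ := lift hb
  obtain ⟨e', he', rfl, het'⟩ := lift hc
  have hlt := hsl _ (mem_image_of_mem _ he) _ (mem_image_of_mem _ he') het het'
  refine absurd (hbc.trans ?_) (not_le.2 hlt)
  refine ContinuousLinearMap.opNorm_le_bound _ (norm_nonneg _) fun v => ?_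
  exact ((WeakDual.toStrongDual e.1 - WeakDual.toStrongDual e'.1).le_opNorm (v : X))

end Asplund

/-! ### Approximate retractions, preserved functionals and subdifferentials -/

section ApproxRetraction

open Filter Topology

/-- `ρ` is, along `l`, asymptotically an additive isometric retraction onto `V`. -/
structure IsApproxRetraction {X T : Type*} [NormedAddCommGroup X] [NormedSpace ℝ X] (l : Filter T)
    (ρ : T → X → X) (V : Submodule ℝ X) : Prop where
  mem : ∀ x, ∀ᶠ t in l, ρ t x ∈ V
  fix : ∀ x ∈ V, Tendsto (fun t => ρ t x) l (𝓝 x)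
  dist : ∀ x y, Tendsto (fun t => dist (ρ t x) (ρ t y)) l (𝓝 (dist x y))
  add : ∀ x y, Tendsto (fun t => ρ t x + ρ t y - ρ t (x + y)) l (𝓝 0)

/-- The functionals that are asymptotically preserved by `ρ` along `l`. -/
def preservedDual {X T : Type*} [NormedAddCommGroup X] [NormedSpace ℝ X] (l : Filter T)
    (ρ : T → X → X) : Submodule ℝ (StrongDual ℝ X) where
  carrier := {x' | ∀ x, Tendsto (fun t => x' (ρ t x)) l (𝓝 (x' x))}
  add_mem' ha hb x := (ha x).add (hb x)
  zero_mem' _ := tendsto_const_nhds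
  smul_mem' c _ ha x := (ha x).const_smul c

namespace IsApproxRetraction

variable {X T : Type*} [NormedAddCommGroup X] [NormedSpace ℝ X] {l : Filter T} {ρ : T → X → X}
  {V : Submodule ℝ X}

theorem dist_of_mem (h : IsApproxRetraction l ρ V) (x : X) {v : X} (hv : v ∈ V) :
    Tendsto (fun t => Dist.dist (ρ t x) v) l (𝓝 (Dist.dist x v)) := by
  refine tendsto_of_tendsto_of_dist (h.dist x v) ?_
  refine squeeze_zero (fun _ => dist_nonneg) (fun t => ?_)
    (tendsto_iff_dist_tendsto_zero.1 (h.fix v hv))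
  rw [Real.dist_eq, dist_comm (ρ t x), dist_comm (ρ t x)]
  exact abs_dist_sub_le _ _ _

theorem norm (h : IsApproxRetraction l ρ V) (x : X) :
    Tendsto (fun t => ‖ρ t x‖) l (𝓝 ‖x‖) := by
  simpa using h.dist_of_mem x V.zero_mem

/-- x*(x) is the limit of x*(ρ x), where eventually ρ x ∈ V and ‖ρ x‖ → ‖x‖. -/
theorem norm_restrictDual [l.NeBot] (h : IsApproxRetraction l ρ V) {x' : StrongDual ℝ X}
    (hx' : x' ∈ preservedDual l ρ) : ‖restrictDual V x'‖ = ‖x'‖ := by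
  refine le_antisymm (ContinuousLinearMap.opNorm_le_bound _ (norm_nonneg x') fun v =>
    x'.le_opNorm (v : X)) (ContinuousLinearMap.opNorm_le_bound _ (ContinuousLinearMap.opNorm_nonneg _) fun x => ?_)
  refine le_of_tendsto_of_tendsto (hx' x).norm ((h.norm x).const_mul _) ?_
  filter_upwards [h.mem x] with t ht using (restrictDual V x').le_opNorm ⟨ρ t x, ht⟩

theorem isometry_restrictDual [l.NeBot] (h : IsApproxRetraction l ρ V) :
    Isometry fun x' : preservedDual l ρ => restrictDual V x'.1 := by
  let R : preservedDual l ρ →L[ℝ] StrongDual ℝ V :=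
    (ContinuousLinearMap.precomp ℝ V.subtypeL).comp (preservedDual l ρ).subtypeL
  exact AddMonoidHomClass.isometry_of_norm R fun x' => h.norm_restrictDual x'.2

/-- Take any Hahn–Banach extension y* and replace it by x ↦ lim y*(ρ x), which exists along an
ultrafilter by boundedness. The limit agrees with y* on V, where ρ eventually takes its values, so
it is preserved. Homogeneity of ρ is not needed: a continuous additive map is real-linear. -/
theorem exists_preserved_extension {l : Ultrafilter T} (h : IsApproxRetraction (l : Filter T) ρ V)
    (v' : StrongDual ℝ V) :
    ∃ x' ∈ preservedDual (l : Filter T) ρ, restrictDual V x' = v' := by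
  obtain ⟨y', hy', -⟩ := exists_extension_norm_eq V v'
  have hlim (x : X) : ∃ r, Tendsto (fun t => y' (ρ t x)) l (𝓝 r) := by
    have hb : ∀ᶠ t in (l : Filter T),
        y' (ρ t x) ∈ Metric.closedBall (0 : ℝ) (‖y'‖ * (‖x‖ + 1)) := by
      filter_upwards [(h.norm x).eventually_le_const (lt_add_one ‖x‖)] with t ht
      rw [mem_closedBall_zero_iff]
      exact y'.le_opNorm_of_le ht
    obtain ⟨r, -, hr⟩ := (isCompact_closedBall (0 : ℝ) _).ultrafilter_le_nhds
      (l.map fun t => y' (ρ t x)) (le_principal_iff.2 hb)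
    exact ⟨r, hr⟩
  choose F hF using hlim
  have hadd (x y : X) : F (x + y) = F x + F y := by
    have h1 := ((hF x).add (hF y)).sub (hF (x + y))
    have h2 := (y'.continuous.tendsto 0).comp (h.add x y)
    simp only [Function.comp_def, map_sub, map_add, map_zero] at h2
    linarith [tendsto_nhds_unique h1 h2]
  have hle (x : X) : ‖F x‖ ≤ ‖y'‖ * ‖x‖ :=
    le_of_tendsto_of_tendsto (hF x).norm ((h.norm x).const_mul _)
      (Eventually.of_forall fun t => y'.le_opNorm _)
  let G : X →+ ℝ := AddMonoidHom.mk' F hadd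
  have hG : Continuous G := AddMonoidHomClass.continuous_of_bound G ‖y'‖ hle
  have hGV (v : X) (hv : v ∈ V) : F v = y' v :=
    tendsto_nhds_unique (hF v) ((y'.continuous.tendsto v).comp (h.fix v hv))
  refine ⟨G.toRealLinearMap hG, fun x => ?_, ?_⟩
  · refine (hF x).congr' ?_
    filter_upwards [h.mem x] with t ht using (hGV _ ht).symm
  · ext v
    exact (hGV v v.2).trans (hy' v)

theorem surjective_restrictDual {l : Ultrafilter T}
    (h : IsApproxRetraction (l : Filter T) ρ V) :
    Function.Surjective fun x' : preservedDual (l : Filter T) ρ => restrictDual V x'.1 := by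
  intro v'
  obtain ⟨x', hx', hv'⟩ := h.exists_preserved_extension v'
  exact ⟨⟨x', hx'⟩, hv'⟩

theorem isClosed_preservedDual {l : Ultrafilter T} (h : IsApproxRetraction (l : Filter T) ρ V) :
    IsClosed (preservedDual (l : Filter T) ρ : Set (StrongDual ℝ X)) := by
  let e := IsometryEquiv.mk (Equiv.ofBijective _
    ⟨h.isometry_restrictDual.injective, h.surjective_restrictDual⟩) h.isometry_restrictDual
  have : CompleteSpace (preservedDual (l : Filter T) ρ) :=
    e.completeSpace_iff.2 inferInstance
  exact (completeSpace_coe_iff_isComplete.1 this).isClosed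

theorem isSeparable_preservedDual {l : Ultrafilter T}
    (h : IsApproxRetraction (l : Filter T) ρ V) [SeparableSpace (StrongDual ℝ V)] :
    IsSeparable (preservedDual (l : Filter T) ρ : Set (StrongDual ℝ X)) := by
  let e := IsometryEquiv.mk (Equiv.ofBijective _
    ⟨h.isometry_restrictDual.injective, h.surjective_restrictDual⟩) h.isometry_restrictDual
  have : SeparableSpace (preservedDual (l : Filter T) ρ) :=
    e.symm.surjective.denseRange.separableSpace e.symm.continuous
  exact IsSeparable.of_subtype _

end IsApproxRetraction

theorem EReal.coe_lt_sub_sub_coe_iff (c r s : ℝ) (e : EReal) :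
    (c : EReal) < e - r - s ↔ ((c + s + r : ℝ) : EReal) < e := by
  induction e with
  | bot => simp
  | top => simpa using EReal.coe_lt_top (c + s + r)
  | coe e =>
    norm_cast
    constructor <;> intro h <;> linarith

theorem restrictDual_mem_frechetSubdiff {X : Type*} [NormedAddCommGroup X] [NormedSpace ℝ X]
    {f : X → EReal} {V : Submodule ℝ X} {v : V} {x' : StrongDual ℝ X}
    (h : x' ∈ frechetSubdiff f v.1) :
    restrictDual V x' ∈ frechetSubdiff (fun w : V => f w.1) v := by
  refine ⟨h.1, fun ε hε => ?_⟩
  obtain ⟨δ, hδ, hh⟩ := h.2 ε hε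
  exact ⟨δ, hδ, fun w h0 h1 => hh w.1 h0 h1⟩

/-- The inequality for an increment k in X is the limit of those for the increments ρ(v + k) - v in
V, whose norms tend to ‖k‖. -/
theorem IsApproxRetraction.mem_frechetSubdiff {X T : Type*} [NormedAddCommGroup X]
    [NormedSpace ℝ X] {l : Filter T} [l.NeBot] {ρ : T → X → X} {V : Submodule ℝ X}
    (h : IsApproxRetraction l ρ V) {f : X → EReal} (hbot : ∀ x, f x ≠ ⊥)
    (hf : ∀ x, Tendsto (fun t => f (ρ t x)) l (𝓝 (f x))) {v : V} {x' : StrongDual ℝ X}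
    (hx' : x' ∈ preservedDual l ρ)
    (hv : restrictDual V x' ∈ frechetSubdiff (fun w : V => f w.1) v) :
    x' ∈ frechetSubdiff f v.1 := by
  obtain ⟨hlt, hε⟩ := hv
  refine ⟨hlt, fun ε ε0 => ?_⟩
  -- Only a weak inequality survives the limit; halving ε restores strictness, as k ≠ 0.
  obtain ⟨δ, hδ, hh⟩ := hε (ε / 2) (by positivity)
  refine ⟨δ, hδ, fun k hk0 hkδ => ?_⟩
  obtain ⟨r, hr⟩ : ∃ r : ℝ, f v.1 = r := ⟨(f v.1).toReal, (EReal.coe_toReal hlt.ne (hbot _)).symm⟩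
  simp only [hr, EReal.coe_lt_sub_sub_coe_iff] at hh ⊢
  have hd : Tendsto (fun t => ‖ρ t (v + k) - v‖) l (𝓝 ‖k‖) := by
    simpa [dist_eq_norm] using h.dist_of_mem (v + k) v.2
  have hlim : Tendsto (fun t => ((-(ε / 2 * ‖ρ t (v + k) - v‖) + (x' (ρ t (v + k)) - x' v) + r : ℝ)
      : EReal)) l (𝓝 ((-(ε / 2 * ‖k‖) + (x' (v + k) - x' v) + r : ℝ) : EReal)) :=
    (continuous_coe_real_ereal.tendsto _).comp
      ((((hd.const_mul _).neg).add ((hx' _).sub tendsto_const_nhds)).add tendsto_const_nhds)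
  have hle := le_of_tendsto_of_tendsto hlim (hf (v + k)) (by
    filter_upwards [h.mem (v + k), hd.eventually_const_lt hk0, hd.eventually_lt_const hkδ]
      with t ht h0 h1
    have := hh (⟨ρ t (v + k), ht⟩ - v) h0 h1
    have hvw : (v : X) + (ρ t (v + k) - v) = ρ t (v + k) := by abel
    have h2 : restrictDual V x' (⟨ρ t (v + k), ht⟩ - v) = x' (ρ t (v + k)) - x' v :=
      map_sub x' _ _
    rw [h2] at this
    refine this.le.trans_eq ?_
    exact congrArg f hvw)
  refine lt_of_lt_of_le (EReal.coe_lt_coe_iff.2 ?_) hle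
  rw [map_add]
  have : 0 < ε * ‖k‖ := by positivity
  linarith

end ApproxRetraction

/-! ### Elementary subspaces of a normed space with operators -/

section OperatorData

open Filter Topology

variable {P Q J : Type*} [NormedAddCommGroup P] [NormedSpace ℝ P] [TopologicalSpace Q]

/-- The data recording the distance, the addition, the operators `L j` and the function `g`. -/
def operatorData (L : J → P →L[ℝ] P) (g : P → Q) (a b c : P) : ℝ × ℝ × (J → ℝ) × Q :=
  (dist a b, ‖a + b - c‖, fun j => ‖L j a - b‖, g a)

/-- The relations a + b = c and L j a = b are recorded as zeros of norms; preserving these zeros in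
the limit makes τ asymptotically additive and commuting with each L j. -/
theorem IsElementary.exists_filter {L : J → P →L[ℝ] P} {g : P → Q} {W : Set P}
    (h : IsElementary (operatorData L g) W) :
    ∃ l : Filter (P → P), l.NeBot ∧ (∀ a, ∀ᶠ τ in l, τ a ∈ W) ∧
      (∀ a ∈ W, Tendsto (fun τ => τ a) l (𝓝 a)) ∧
      (∀ a b, Tendsto (fun τ => dist (τ a) (τ b)) l (𝓝 (dist a b))) ∧
      (∀ a b, Tendsto (fun τ => τ a + τ b - τ (a + b)) l (𝓝 0)) ∧
      (∀ j a, Tendsto (fun τ => L j (τ a) - τ (L j a)) l (𝓝 0)) ∧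
      ∀ a, Tendsto (fun τ => g (τ a)) l (𝓝 (g a)) := by
  obtain ⟨l, hne, hmem, hfix, hpres⟩ := h
  refine ⟨l, hne, hmem, hfix, fun a b => (hpres a b a).fst_nhds, fun a b => ?_, fun j a => ?_,
    fun a => (hpres a a a).snd_nhds.snd_nhds.snd_nhds⟩
  · have h1 := (hpres a b (a + b)).snd_nhds.fst_nhds
    simp only [operatorData, sub_self, norm_zero] at h1
    exact tendsto_zero_iff_norm_tendsto_zero.2 h1
  · have h1 := tendsto_pi_nhds.1 (hpres a (L j a) a).snd_nhds.snd_nhds.fst_nhds j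
    simp only [operatorData, sub_self, norm_zero] at h1
    exact tendsto_zero_iff_norm_tendsto_zero.2 h1

/-- For a, b ∈ W the sum is the limit of τ(a + b), which eventually lies in the closed set W. -/
theorem IsElementary.add_mem {L : J → P →L[ℝ] P} {g : P → Q} {W : Set P}
    (h : IsElementary (operatorData L g) W) (hW : IsClosed W) {a b : P} (ha : a ∈ W) (hb : b ∈ W) :
    a + b ∈ W := by
  obtain ⟨l, hne, hmem, hfix, -, hadd, -, -⟩ := h.exists_filter
  have h1 := ((hfix a ha).add (hfix b hb)).sub (hadd a b)
  simp only [sub_sub_cancel, sub_zero] at h1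
  exact hW.mem_of_tendsto h1 (hmem _)

theorem IsElementary.map_mem {L : J → P →L[ℝ] P} {g : P → Q} {W : Set P}
    (h : IsElementary (operatorData L g) W) (hW : IsClosed W) (j : J) {a : P} (ha : a ∈ W) :
    L j a ∈ W := by
  obtain ⟨l, hne, hmem, hfix, -, -, hL, -⟩ := h.exists_filter
  have h1 := (((L j).continuous.tendsto a).comp (hfix a ha)).sub (hL j a)
  simp only [Function.comp_def, sub_sub_cancel, sub_zero] at h1
  exact hW.mem_of_tendsto h1 (hmem _)

theorem isSigmaComplete_isElementary (L : J → P →L[ℝ] P) (g : P → Q) :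
    IsSigmaComplete {W : SepSubspace P | IsElementary (operatorData L g) (W.1 : Set P)} := by
  intro r hr hrR
  have hdir : Directed (· ≤ ·) fun n => (r n).1 := fun m n =>
    ⟨max m n, hr (le_max_left m n), hr (le_max_right m n)⟩
  have hU : (((⨆ n, (r n).1) : Submodule ℝ P) : Set P) = ⋃ n, ((r n).1 : Set P) :=
    Submodule.coe_iSup_of_directed _ hdir
  refine ⟨⟨(⨆ n, (r n).1).topologicalClosure, Submodule.isClosed_topologicalClosure _, ?_⟩,
    ?_, ?_, fun S hS => ?_⟩
  · rw [Submodule.topologicalClosure_coe, hU]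
    exact (IsSeparable.iUnion fun n => (r n).2.2).closure
  · show IsElementary _ (((⨆ n, (r n).1).topologicalClosure : Submodule ℝ P) : Set P)
    rw [Submodule.topologicalClosure_coe, hU]
    exact IsElementary.closure_iUnion (δ := Prod.fst) continuous_fst (fun _ _ _ => rfl)
      (fun m n hmn => hr hmn) hrR
  · rintro _ ⟨n, rfl⟩
    exact (le_iSup (fun n => (r n).1) n).trans (Submodule.le_topologicalClosure _)
  · exact Submodule.topologicalClosure_minimal _
      (iSup_le fun n => hS (mem_range_self n)) S.2.1

theorem isCofinal_isElementary [T3Space Q] [SecondCountableTopology Q] [Countable J]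
    (L : J → P →L[ℝ] P) (g : P → Q)
    (hL : ∀ q : ℚ, ∃ j, L j = (q : ℝ) • ContinuousLinearMap.id ℝ P) :
    IsCofinal {W : SepSubspace P | IsElementary (operatorData L g) (W.1 : Set P)} := by
  intro W
  obtain ⟨S, hS, hWS⟩ := W.2.2
  obtain ⟨C, hSC, hC, hel⟩ := exists_countable_isElementary_closure
    (Φ := operatorData L g) (δ := Prod.fst) continuous_fst (fun _ _ _ => rfl) hS
  have hWC : (W.1 : Set P) ⊆ closure C := hWS.trans (closure_mono hSC)
  let M : Submodule ℝ P :=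
    { carrier := closure C
      add_mem' := fun ha hb => hel.add_mem isClosed_closure ha hb
      zero_mem' := hWC W.1.zero_mem
      -- Rational multiples are among the L j; real ones follow by density and closedness.
      smul_mem' := fun s a ha => by
        have hcl : IsClosed {s : ℝ | s • a ∈ closure C} :=
          isClosed_closure.preimage (continuous_id.smul continuous_const)
        have huniv := hcl.closure_eq ▸ (Rat.denseRange_cast (𝕜 := ℝ)).closure_eq ▸
          closure_mono (s := range ((↑) : ℚ → ℝ)) (t := {s : ℝ | s • a ∈ closure C}) (by
            rintro _ ⟨q, rfl⟩
            obtain ⟨j, hj⟩ := hL q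
            have := hel.map_mem isClosed_closure j ha
            rw [hj] at this
            exact this)
        exact huniv (mem_univ s) }
  exact ⟨⟨M, isClosed_closure, hC.isSeparable.closure⟩, hel, hWC⟩

end OperatorData

/-! ### Blocks in the product space -/

section Block

variable {k : ℕ} {Z : Fin k → Type*} [∀ i, NormedAddCommGroup (Z i)] [∀ i, NormedSpace ℝ (Z i)]
  {X : Type*} [NormedAddCommGroup X] [NormedSpace ℝ X]

/-- The embedding of the `i`-th factor `Zᵢ` into `Z₁ × ⋯ × Zₖ × X`. -/
noncomputable def factorEmbedding (Z : Fin k → Type*) [∀ i, NormedAddCommGroup (Z i)]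
    [∀ i, NormedSpace ℝ (Z i)] (X : Type*) [NormedAddCommGroup X] [NormedSpace ℝ X] (i : Fin k) :
    Z i →L[ℝ] (∀ i, Z i) × X :=
  (ContinuousLinearMap.inl ℝ (∀ i, Z i) X).comp (ContinuousLinearMap.single ℝ Z i)

/-- The projection of `Z₁ × ⋯ × Zₖ × X` onto the `i`-th factor `Zᵢ`. -/
noncomputable def factorProjection (Z : Fin k → Type*) [∀ i, NormedAddCommGroup (Z i)]
    [∀ i, NormedSpace ℝ (Z i)] (X : Type*) [NormedAddCommGroup X] [NormedSpace ℝ X] (i : Fin k) :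
    (∀ i, Z i) × X →L[ℝ] Z i :=
  (ContinuousLinearMap.proj i).comp (ContinuousLinearMap.fst ℝ (∀ i, Z i) X)

@[simp]
theorem factorProjection_apply (i : Fin k) (p : (∀ i, Z i) × X) :
    factorProjection Z X i p = p.1 i := rfl

@[simp]
theorem factorProjection_factorEmbedding (i : Fin k) (z : Z i) :
    factorProjection Z X i (factorEmbedding Z X i z) = z := by
  simp [factorEmbedding]

theorem norm_factorEmbedding (i : Fin k) (z : Z i) : ‖factorEmbedding Z X i z‖ = ‖z‖ := by
  simp [factorEmbedding, Prod.norm_def, Pi.norm_single]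

theorem norm_factorProjection_le (i : Fin k) (p : (∀ i, Z i) × X) :
    ‖factorProjection Z X i p‖ ≤ ‖p‖ :=
  (norm_le_pi_norm p.1 i).trans (norm_fst_le p)

theorem sum_factorEmbedding (p : (∀ i, Z i) × X) :
    ∑ i, factorEmbedding Z X i (p.1 i) + ContinuousLinearMap.inr ℝ (∀ i, Z i) X p.2 = p := by
  ext i
  · simp [factorEmbedding, Prod.fst_sum, Finset.univ_sum_single]
  · simp [factorEmbedding, Prod.snd_sum]

theorem mem_block {U : ∀ i, SepSubspace (Z i)} {V : SepSubspace X} {p : (∀ i, Z i) × X} :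
    p ∈ (block U V).1 ↔ (∀ i, p.1 i ∈ (U i).1) ∧ p.2 ∈ V.1 := by
  simp [block, Submodule.mem_prod, Submodule.mem_pi]

theorem factorEmbedding_mem_block {U : ∀ i, SepSubspace (Z i)} {V : SepSubspace X} {i : Fin k}
    {z : Z i} (hz : z ∈ (U i).1) : factorEmbedding Z X i z ∈ (block U V).1 := by
  refine mem_block.2 ⟨fun j => ?_, V.1.zero_mem⟩
  obtain rfl | hj := eq_or_ne j i
  · simpa [factorEmbedding] using hz
  · simp [factorEmbedding, hj]

theorem exists_eq_block {W : SepSubspace ((∀ i, Z i) × X)}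
    (hZ : ∀ p ∈ W.1, ∀ i, factorEmbedding Z X i (p.1 i) ∈ W.1)
    (hX : ∀ p ∈ W.1, ContinuousLinearMap.inr ℝ (∀ i, Z i) X p.2 ∈ W.1) :
    ∃ (U : ∀ i, SepSubspace (Z i)) (V : SepSubspace X), W = block U V := by
  refine ⟨fun i => ⟨W.1.comap (factorEmbedding Z X i).toLinearMap,
      W.2.1.preimage (factorEmbedding Z X i).continuous,
      (W.2.2.image (factorProjection Z X i).continuous).mono fun z hz =>
        ⟨_, hz, factorProjection_factorEmbedding i z⟩⟩,
    ⟨W.1.comap (ContinuousLinearMap.inr ℝ (∀ i, Z i) X).toLinearMap,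
      W.2.1.preimage (ContinuousLinearMap.inr ℝ (∀ i, Z i) X).continuous,
      (W.2.2.image continuous_snd).mono fun x hx => ⟨_, hx, rfl⟩⟩, ?_⟩
  refine Subtype.ext (Submodule.ext fun p => ?_)
  rw [mem_block]
  refine ⟨fun hp => ⟨hZ p hp, hX p hp⟩, fun hp => ?_⟩
  rw [← sum_factorEmbedding p]
  exact W.1.add_mem (W.1.sum_mem fun i _ => hp.1 i) hp.2

/-- Rational multiples of the identity, the projections onto the factors and the operators
`(z, x) ↦ (0, Tᵢ zᵢ)`. -/
noncomputable def blockOperators (T : ∀ i, Z i →L[ℝ] X) :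
    ℚ ⊕ Fin k ⊕ Fin k ⊕ Unit → ((∀ i, Z i) × X →L[ℝ] (∀ i, Z i) × X) :=
  Sum.elim (fun q => (q : ℝ) • ContinuousLinearMap.id ℝ _) <|
  Sum.elim (fun i => (factorEmbedding Z X i).comp (factorProjection Z X i)) <|
  Sum.elim (fun i => (ContinuousLinearMap.inr ℝ (∀ i, Z i) X).comp
    ((T i).comp (factorProjection Z X i)))
  fun _ => (ContinuousLinearMap.inr ℝ (∀ i, Z i) X).comp (ContinuousLinearMap.snd ℝ (∀ i, Z i) X)

/-- The data preserved by the separable reduction of `f`, `T` and `z'`. -/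
noncomputable def blockData (z' : ∀ i, StrongDual ℝ (Z i)) (T : ∀ i, Z i →L[ℝ] X) (f : X → EReal) :=
  operatorData (blockOperators T) fun p : (∀ i, Z i) × X =>
    ((fun i => z' i (p.1 i), f p.2) : (Fin k → ℝ) × EReal)

variable {z' : ∀ i, StrongDual ℝ (Z i)} {T : ∀ i, Z i →L[ℝ] X} {f : X → EReal}

theorem IsElementary.exists_eq_block {W : SepSubspace ((∀ i, Z i) × X)}
    (h : IsElementary (blockData z' T f) (W.1 : Set ((∀ i, Z i) × X))) :
    ∃ (U : ∀ i, SepSubspace (Z i)) (V : SepSubspace X), W = block U V :=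
  _root_.exists_eq_block (fun _ hp i => h.map_mem W.2.1 (.inr (.inl i)) hp)
    fun _ hp => h.map_mem W.2.1 (.inr (.inr (.inr ()))) hp

variable {U : ∀ i, SepSubspace (Z i)} {V : SepSubspace X}

theorem IsElementary.mapsTo_of_block
    (h : IsElementary (blockData z' T f) ((block U V).1 : Set ((∀ i, Z i) × X))) (i : Fin k) :
    MapsTo (T i) (U i).1 V.1 := by
  intro z hz
  have h1 := h.map_mem (block U V).2.1 (.inr (.inr (.inl i))) (factorEmbedding_mem_block hz)
  have h2 := (mem_block.1 h1).2
  simpa [blockOperators, factorEmbedding] using h2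

open Filter Topology

/-- Both ρ and σ are coordinates of τ on embedded factors. They intertwine with T i because τ
asymptotically commutes with (z, x) ↦ (0, Tᵢ zᵢ). An ultrafilter is taken so that bounded limits
exist. -/
theorem IsElementary.exists_ultrafilter_of_block
    (h : IsElementary (blockData z' T f) ((block U V).1 : Set ((∀ i, Z i) × X))) :
    ∃ (l : Ultrafilter ((∀ i, Z i) × X → (∀ i, Z i) × X)) (ρ : _ → X → X),
      IsApproxRetraction (l : Filter _) ρ V.1 ∧
      (∀ x, Tendsto (fun τ => f (ρ τ x)) l (𝓝 (f x))) ∧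
      ∀ i, ∃ σ : ((∀ i, Z i) × X → (∀ i, Z i) × X) → Z i → Z i, ∀ z,
        (∀ᶠ τ in (l : Filter _), σ τ z ∈ (U i).1) ∧
        (∀ r > ‖z‖, ∀ᶠ τ in (l : Filter _), ‖σ τ z‖ ≤ r) ∧
        Tendsto (fun τ => z' i (σ τ z)) l (𝓝 (z' i z)) ∧
        Tendsto (fun τ => T i (σ τ z) - ρ τ (T i z)) l (𝓝 0) := by
  obtain ⟨l', hne, hmem, hfix, hdist, hadd, hL, hg⟩ := h.exists_filter
  have hle : (Ultrafilter.of l' : Filter _) ≤ l' := Ultrafilter.of_le l'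
  refine ⟨Ultrafilter.of l', fun τ x => (τ (0, x)).2, ⟨fun x => ?_, fun x hx => ?_, fun x y => ?_,
    fun x y => ?_⟩, fun x => ((hg (0, x)).snd_nhds).mono_left hle,
    fun i => ⟨fun τ z => (τ (factorEmbedding Z X i z)).1 i, fun z => ⟨?_, ?_, ?_, ?_⟩⟩⟩
  · exact ((hmem (0, x)).mono fun τ hτ => (mem_block.1 hτ).2).filter_mono hle
  · exact ((hfix (0, x) (mem_block.2 ⟨fun i => (U i).1.zero_mem, hx⟩)).snd_nhds).mono_left hle
  -- τ(0, x) need not lie in the factor X, but τ asymptotically commutes with the projection onto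
  -- that factor, which fixes (0, x). So the other coordinates vanish in the limit and ρ inherits
  -- distances from τ.
  · have hfst (x : X) : Tendsto (fun τ : (∀ i, Z i) × X → (∀ i, Z i) × X => (τ (0, x)).1) l'
        (𝓝 0) := by
      simpa [blockOperators] using (hL (.inr (.inr (.inr ()))) (0, x)).fst_nhds.neg
    have h1 : Tendsto (fun τ => dist ((0 : ∀ i, Z i), (τ (0, x)).2) (0, (τ (0, y)).2)) l'
        (𝓝 (dist ((0 : ∀ i, Z i), x) (0, y))) := by
      refine tendsto_of_tendsto_of_dist (hdist (0, x) (0, y)) ?_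
      refine squeeze_zero (fun _ => dist_nonneg) (fun τ => dist_dist_dist_le _ _ _ _) ?_
      have h2 (x : X) : Tendsto (fun τ : (∀ i, Z i) × X → (∀ i, Z i) × X =>
          dist (τ (0, x)) (0, (τ (0, x)).2)) l' (𝓝 0) := by
        simpa [Prod.dist_eq] using (hfst x).norm
      simpa using (h2 x).add (h2 y)
    simpa [Prod.dist_eq] using h1.mono_left hle
  · simpa using ((hadd (0, x) (0, y)).snd_nhds).mono_left hle
  · exact ((hmem _).mono fun τ hτ => (mem_block.1 hτ).1 i).filter_mono hle
  · intro r hr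
    have h0 := (hdist (factorEmbedding Z X i z) 0)
    have h1 : Tendsto (fun τ => ‖τ (factorEmbedding Z X i z)‖) l' (𝓝 ‖z‖) := by
      have h2 := hfix 0 (block U V).1.zero_mem
      have h3 : Tendsto (fun τ : (∀ i, Z i) × X → (∀ i, Z i) × X =>
          dist (τ (factorEmbedding Z X i z)) 0) l' (𝓝 (dist (factorEmbedding Z X i z) 0)) := by
        refine tendsto_of_tendsto_of_dist h0 ?_
        refine squeeze_zero (fun _ => dist_nonneg) (fun τ => dist_dist_dist_le _ _ _ _) ?_
        simpa using (tendsto_iff_dist_tendsto_zero.1 h2)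
      simpa [norm_factorEmbedding] using h3
    refine ((h1.eventually_le_const hr).mono fun τ hτ => ?_).filter_mono hle
    exact (norm_factorProjection_le i _).trans hτ
  · have h1 := (tendsto_pi_nhds.1 (hg (factorEmbedding Z X i z)).fst_nhds i).mono_left hle
    simpa [factorEmbedding] using h1
  · have h1 := (hL (.inr (.inr (.inl i))) (factorEmbedding Z X i z)).snd_nhds.mono_left hle
    simpa [blockOperators, factorEmbedding] using h1

/-- The value of T*x* - z* at z is the limit of its values at σ z ∈ U, whose norms are eventually at
most any r > ‖z‖; then r decreases to ‖z‖. -/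
theorem norm_dualOp_sub_eq {Z X S : Type*} [NormedAddCommGroup Z] [NormedSpace ℝ Z]
    [NormedAddCommGroup X] [NormedSpace ℝ X] {T : Z →L[ℝ] X} {z' : StrongDual ℝ Z}
    {U : Submodule ℝ Z} {V : Submodule ℝ X} (hT : MapsTo T U V) {l : Filter S} [l.NeBot]
    {ρ : S → X → X} {σ : S → Z → Z} {x' : StrongDual ℝ X} (hx' : x' ∈ preservedDual l ρ)
    (hσ : ∀ z, (∀ᶠ τ in l, σ τ z ∈ U) ∧ (∀ r > ‖z‖, ∀ᶠ τ in l, ‖σ τ z‖ ≤ r) ∧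
      Tendsto (fun τ => z' (σ τ z)) l (𝓝 (z' z)) ∧
      Tendsto (fun τ => T (σ τ z) - ρ τ (T z)) l (𝓝 0)) :
    ‖dualOp T x' - z'‖ =
      ‖dualOp (T.restrict hT) (restrictDual V x') - restrictDual U z'‖ := by
  set u' := dualOp (T.restrict hT) (restrictDual V x') - restrictDual U z' with hu'
  have hu (u : U) : u' u = x' (T u) - z' u := rfl
  refine le_antisymm (ContinuousLinearMap.opNorm_le_bound _ (ContinuousLinearMap.opNorm_nonneg _)
    fun z => ?_) (ContinuousLinearMap.opNorm_le_bound _ (norm_nonneg (dualOp T x' - z'))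
    fun u => (dualOp T x' - z').le_opNorm u)
  obtain ⟨hU, hn, hz, hTz⟩ := hσ z
  have h1 : Tendsto (fun τ => x' (T (σ τ z)) - z' (σ τ z)) l (𝓝 (x' (T z) - z' z)) := by
    have h2 := (((x'.continuous.tendsto 0).comp hTz).add (hx' (T z))).sub hz
    simpa [Function.comp_def] using h2
  have h3 (r : ℝ) (hr : ‖z‖ < r) : ‖x' (T z) - z' z‖ ≤ ‖u'‖ * r := by
    refine le_of_tendsto h1.norm ?_
    filter_upwards [hU, hn r hr] with τ h4 h5
    exact u'.le_opNorm_of_le (x := ⟨σ τ z, h4⟩) h5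
  refine ge_of_tendsto (x := 𝓝[>] ‖z‖) (((continuous_const.mul continuous_id).tendsto _).mono_left
    nhdsWithin_le_nhds) ?_
  filter_upwards [self_mem_nhdsWithin] with r hr using h3 r hr

end Block

/-! ### The separable reduction theorem -/

theorem theorem3p6 {X : Type*} [NormedAddCommGroup X] [NormedSpace ℝ X] [CompleteSpace X]
    (hX : IsAsplund X) (k : ℕ) {Z : Fin k → Type*} [∀ i, NormedAddCommGroup (Z i)]
    [∀ i, NormedSpace ℝ (Z i)] [∀ i, CompleteSpace (Z i)]
    (z' : ∀ i, StrongDual ℝ (Z i)) (T : ∀ i, Z i →L[ℝ] X)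
    (f : X → EReal) (hf : IsProperFun f) :
    ∃ R : Set (SepSubspace ((∀ i, Z i) × X)),
      (∀ W ∈ R, ∃ (U : ∀ i, SepSubspace (Z i)) (V : SepSubspace X), W = block U V) ∧
      IsRich R ∧
      ∀ (U : ∀ i, SepSubspace (Z i)) (V : SepSubspace X), block U V ∈ R →
        ∃ hT : ∀ i, MapsTo (T i) (U i).1 V.1,
        ∃ Y : SepSubspace (StrongDual ℝ X),
          (Isometry (fun x' : Y.1 => restrictDual V.1 x'.1) ∧
            Function.Surjective (fun x' : Y.1 => restrictDual V.1 x'.1)) ∧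
          (∀ v : V.1,
            restrictDual V.1 '' (frechetSubdiff f v.1 ∩ Y.1) =
                restrictDual V.1 '' frechetSubdiff f v.1 ∧
              restrictDual V.1 '' frechetSubdiff f v.1 =
                frechetSubdiff (fun w : V.1 => f w.1) v) ∧
          ∀ x' ∈ Y.1, ∀ i,
            ‖dualOp (T i) x' - z' i‖ =
              ‖dualOp ((T i).restrict (hT i)) (restrictDual V.1 x') -
                restrictDual (U i).1 (z' i)‖ := by
  refine ⟨{W | IsElementary (blockData z' T f) (W.1 : Set ((∀ i, Z i) × X))},
    fun W hW => IsElementary.exists_eq_block hW,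
    ⟨isCofinal_isElementary _ _ fun q => ⟨.inl q, rfl⟩, isSigmaComplete_isElementary _ _⟩,
    fun U V hUV => ⟨hUV.mapsTo_of_block, ?_⟩⟩
  obtain ⟨l, ρ, hρ, hf', hσ⟩ := hUV.exists_ultrafilter_of_block
  have : SeparableSpace V.1 := V.2.2.separableSpace
  have := hX.separableSpace_dual V.1
  refine ⟨⟨preservedDual l ρ, hρ.isClosed_preservedDual, hρ.isSeparable_preservedDual⟩,
    ⟨hρ.isometry_restrictDual, hρ.surjective_restrictDual⟩, fun v => ?_, fun x' hx' i => ?_⟩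
  · have h1 : restrictDual V.1 '' frechetSubdiff f v.1 ⊆
        frechetSubdiff (fun w : V.1 => f w.1) v := by
      rintro _ ⟨x', hx', rfl⟩
      exact restrictDual_mem_frechetSubdiff hx'
    -- The smallest of the three sets in (ii) contains the largest: the extension of v* inside Y is
    -- itself a subgradient of f.
    have h2 : frechetSubdiff (fun w : V.1 => f w.1) v ⊆
        restrictDual V.1 '' (frechetSubdiff f v.1 ∩ preservedDual (l : Filter _) ρ) := by
      intro v' hv'
      obtain ⟨x', hx', rfl⟩ := hρ.exists_preserved_extension v'
      exact ⟨x', ⟨hρ.mem_frechetSubdiff hf.1 hf' hx' hv', hx'⟩, rfl⟩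
    have h3 := image_mono (f := restrictDual V.1)
      (inter_subset_left (s := frechetSubdiff f v.1)
        (t := (preservedDual (l : Filter _) ρ : Set (StrongDual ℝ X))))
    exact ⟨h3.antisymm (h1.trans h2), h1.antisymm (h2.trans h3)⟩
  · obtain ⟨σ, hσ⟩ := hσ i
    exact norm_dualOp_sub_eq (hUV.mapsTo_of_block i) hx' hσ
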